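/- For integers $0\le j\le n$ let $$\begin{bmatrix} n\\ j\end{bmatrix}=\frac{(q;q)_n}{(q;q)_j\,(q;q)_{n-j}},\qquad (q;q)_m=\prod_{i=1}^{m}(1-q^i),$$ be the $q$-binomial coefficient, as a rational function of the indeterminate $q$. **Theorem.** Let $k$ and $n$ be positive integers, let $j\in\{0,\dots,n\}$, and put $g=\gcd(n,j)$. If $k\equiv 0\pmod g$, then $$A_{n,j,k}(q)=\frac{1-q^k}{1-q^n}\begin{bmatrix} n\\ j\end{bmatrix}$$ is a nonzero polynomial in $q$ of degree $D=j(n-j)+k-n$ with nonnegative integer coefficients, and it is reciprocal, that is, $q^{D}A_{n,j,k}(1/q)=A_{n,j,k}(q)$. -/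

import Mathlib

noncomputable section

/-- The `q`-shifted factorial `(a; q)_n = ∏_{i=0}^{n-1} (1 - a q^i)`. -/
def qShiftedFactorial {K : Type*} [Field K] (a q : K) (n : ℕ) : K :=
  ∏ i ∈ Finset.range n, (1 - a * q ^ i)

/-- The `q`-binomial coefficient: `(q;q)_L / ((q;q)_a (q;q)_{L-a})` for `0 ≤ a ≤ L`,
and `0` otherwise. -/
def qBinomial {K : Type*} [Field K] (q : K) (L a : ℕ) : K :=
  if a ≤ L then
    qShiftedFactorial q q L / (qShiftedFactorial q q a * qShiftedFactorial q q (L - a))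
  else 0

/-- The rational function `A_{n,j,k}(q) = (1 - q^k) / (1 - q^n) * [n, j]_q` in the
indeterminate `q = RatFunc.X`. -/
def andrewsA (n j k : ℕ) : RatFunc ℚ :=
  (1 - RatFunc.X ^ k) / (1 - RatFunc.X ^ n) * qBinomial RatFunc.X n j

end

/-!
# Positivity of `(1 - q^k) / (1 - q^n) * [n, j]`

Write `n = m + j`, `g = gcd(n, j)`, and let `G` be the Gaussian polynomial `[n, j]`.

*Polynomiality.* Since `(1 - q^j) [n, j] = (1 - q^n) [n-1, j-1]`, the polynomial `1 - q^n` divides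
both `(1 - q^j) G` and `(1 - q^n) G`, hence `(1 - q^g) G`, because `1 - q^g` is a combination of
`1 - q^n` and `1 - q^j` (`one_sub_X_pow_dvd_mul_gaussPoly`). So `A = (1 - q^g) / (1 - q^n) * G` is
a polynomial, and for `k = g t` the polynomial in question is `A * (1 + q^g + ⋯ + q^(g (t - 1)))`.
Degree and reciprocity are read off from the product formula for `G`.

*Positivity.* It is enough to treat `A`. By reciprocity only the coefficients of `A` up to half of
its degree matter, and there the recursion `A_i = A_{i-n} + (G_i - G_{i-g})` and the unimodality of
`G` give nonnegativity (`coeff_nonneg_of_one_sub_X_pow_mul_eq`).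

*Unimodality.* The coefficient of `q^w` in `G` is the number of monomials in `x₀, …, x_m` of degree
`j` and weight `w`, where `x_i` has weight `i`. The derivations `∑ (m - i) x_{i+1} ∂_i` and
`∑ i x_{i-1} ∂_i` define an action of `sl₂` on polynomials, whose raising operator is injective
from weight `w` to weight `w + 1` as long as `2 w < m j` (`eq_zero_of_raising_eq_zero`), so the
number of monomials does not decrease (`card_weightLevel_le_succ`).
-/

/-! ### Divisibility by `1 - x ^ gcd a b` -/

/-- The element `1 - x ^ gcd a b` lies in the ideal generated by `1 - x ^ a` and `1 - x ^ b`, over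
any commutative ring; here in the form in which it is used for divisibility. -/
theorem dvd_one_sub_pow_gcd_mul {R : Type*} [CommRing R] (x c d : R) (a b : ℕ)
    (ha : d ∣ (1 - x ^ a) * c) (hb : d ∣ (1 - x ^ b) * c) :
    d ∣ (1 - x ^ Nat.gcd a b) * c := by
  induction a, b using Nat.gcd.induction with
  | H0 b => simpa using hb
  | H1 a b _ ih =>
    rw [Nat.gcd_rec]
    refine ih ?_ ha
    have hpow : x ^ b = x ^ (b % a) * (x ^ a) ^ (b / a) := by
      rw [← pow_mul, ← pow_add, Nat.mod_add_div]
    have hdvd : d ∣ (1 - (x ^ a) ^ (b / a)) * c :=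
      ha.trans (mul_dvd_mul_right (by simpa using sub_dvd_pow_sub_pow 1 (x ^ a) (b / a)) c)
    have key : (1 - x ^ (b % a)) * c
        = (1 - x ^ b) * c - x ^ (b % a) * ((1 - (x ^ a) ^ (b / a)) * c) := by
      rw [hpow]; ring
    rw [key]
    exact dvd_sub hb (hdvd.mul_left _)

/-! ### Injectivity of a raising operator -/

/-- A raising operator of an `sl₂`-action is injective below the middle weight: if `E` and `F`
satisfy `[E, F] = 2 w - N` on the weight space `V w`, and `F` lowers weights and kills `V 0`, then
`E` has no nonzero kernel vector in `V w` when `2 w < N`. -/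
theorem eq_zero_of_raising_eq_zero {M : Type*} [AddCommGroup M] [Module ℚ M]
    (E F : M →ₗ[ℚ] M) (V : ℕ → Submodule ℚ M) (N : ℕ)
    (hF_zero : ∀ v ∈ V 0, F v = 0) (hF_succ : ∀ w, ∀ v ∈ V (w + 1), F v ∈ V w)
    (hcomm : ∀ w, ∀ v ∈ V w, E (F v) - F (E v) = (2 * w - N : ℚ) • v)
    {w : ℕ} (hw : 2 * w < N) {v : M} (hv : v ∈ V w) (hEv : E v = 0) : v = 0 := by
  -- The induction needs the larger class of vectors on which `F ∘ E` acts by a scalar `c ≤ 0`.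
  suffices H : ∀ w : ℕ, 2 * w < N → ∀ c : ℚ, c ≤ 0 → ∀ v ∈ V w, F (E v) = c • v → v = 0 from
    H w hw 0 le_rfl v hv (by simp [hEv])
  intro w
  induction w with
  | zero =>
    intro hw c hc v hv hFE
    have h := hcomm 0 v hv
    rw [hF_zero v hv, map_zero, hFE, zero_sub, ← neg_smul, ← sub_eq_zero, ← sub_smul] at h
    refine (smul_eq_zero.1 h).resolve_left ?_
    have : (0 : ℚ) < N := by exact_mod_cast (by omega : 0 < N)
    push_cast
    intro h0
    linarith
  | succ w ih =>
    intro hw c hc v hv hFE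
    have hneg : (2 * ((w + 1 : ℕ) : ℚ) - N) < 0 := by
      have : ((2 * (w + 1) : ℕ) : ℚ) < N := by exact_mod_cast hw
      push_cast at this ⊢
      linarith
    have h := hcomm (w + 1) v hv
    -- Hence `F v`, of weight `w`, belongs to the same class with a smaller scalar, so it vanishes;
    -- then `E (F v) = 0` is a negative multiple of `v`.
    have hEF : E (F v) = (c + (2 * ((w + 1 : ℕ) : ℚ) - N)) • v := by
      rw [add_smul, ← hFE, ← h]; abel
    have hFv : F v = 0 :=
      ih (by omega) (c + (2 * ((w + 1 : ℕ) : ℚ) - N)) (by linarith) (F v)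
        (hF_succ w v hv) (by rw [hEF, map_smul])
    rw [hFv, map_zero] at hEF
    exact (smul_eq_zero.1 hEF.symm).resolve_left (by linarith)

/-! ### The `sl₂`-action on monomials, and unimodality -/

section Gaussian

open Finset

/-- The exponents of the monomials of degree `j` in the variables `x₀, …, x_m`. They correspond to
the partitions with at most `j` parts, all at most `m`. Exponents are taken in all variables
`x_i`, `i : ℕ`, with the support bounded, so that shifting an index needs no bound. -/
noncomputable def boundedExponents (m j : ℕ) : Finset (ℕ →₀ ℕ) :=
  (range (m + 1)).finsuppAntidiag j

/-- The weight of a monomial, where `x_i` has weight `i`; this is the size of the corresponding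
partition. -/
noncomputable def exponentWeight : (ℕ →₀ ℕ) →+ ℕ := Finsupp.weight id

@[simp]
theorem exponentWeight_single (i k : ℕ) : exponentWeight (Finsupp.single i k) = k * i := by
  simp [exponentWeight, Finsupp.weight_single]

theorem mem_boundedExponents {m j : ℕ} {d : ℕ →₀ ℕ} :
    d ∈ boundedExponents m j ↔ d.degree = j ∧ ∀ i, d i ≠ 0 → i ≤ m := by
  rw [boundedExponents, mem_finsuppAntidiag', Finsupp.degree_apply]
  refine and_congr Iff.rfl ⟨fun h i hi => ?_, fun h i hi => ?_⟩
  · have := h (Finsupp.mem_support_iff.2 hi)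
    simp at this; omega
  · have := h i (Finsupp.mem_support_iff.1 hi)
    simp; omega

/-- The exponents of the monomials of degree `j` and weight `w` in `x₀, …, x_m`. -/
noncomputable def weightLevel (m j w : ℕ) : Finset (ℕ →₀ ℕ) :=
  {d ∈ boundedExponents m j | exponentWeight d = w}

theorem mem_weightLevel {m j w : ℕ} {d : ℕ →₀ ℕ} :
    d ∈ weightLevel m j w ↔
      d.degree = j ∧ (∀ i, d i ≠ 0 → i ≤ m) ∧ exponentWeight d = w := by
  rw [weightLevel, mem_filter, mem_boundedExponents, and_assoc]

/-- Replacing one factor `x_i` by `x_{i'}` changes the weight by `i' - i`. -/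
theorem sub_single_add_single_mem_weightLevel {m j w w' : ℕ} {d : ℕ →₀ ℕ}
    (hd : d ∈ weightLevel m j w) {i i' : ℕ} (hi : d i ≠ 0) (hi' : i' ≤ m)
    (hw : w + i' = w' + i) :
    d - Finsupp.single i 1 + Finsupp.single i' 1 ∈ weightLevel m j w' := by
  obtain ⟨hdeg, hle, hwt⟩ := mem_weightLevel.1 hd
  have hsplit : d - Finsupp.single i 1 + Finsupp.single i 1 = d :=
    tsub_add_cancel_of_le (Finsupp.single_le_iff.2 (Nat.one_le_iff_ne_zero.2 hi))
  have h1 := congrArg Finsupp.degree hsplit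
  have h2 := congrArg exponentWeight hsplit
  simp only [map_add, Finsupp.degree_single, exponentWeight_single] at h1 h2
  refine mem_weightLevel.2 ⟨?_, fun l hl => ?_, ?_⟩
  · simp only [map_add, Finsupp.degree_single]; omega
  · by_cases hli : l = i'
    · omega
    · refine hle l fun h0 => hl ?_
      simp [h0, Finsupp.single_apply, Ne.symm hli]
  · simp only [map_add, exponentWeight_single]; omega

open MvPolynomial in
/-- The raising operator `∑ (m - i) x_{i+1} ∂_i`. Its coefficient vanishes at `i = m`, so it preserves
the polynomials in `x₀, …, x_m`. -/
noncomputable def raising (m : ℕ) : Derivation ℚ (MvPolynomial ℕ ℚ) (MvPolynomial ℕ ℚ) :=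
  mkDerivation ℚ fun i => C (m - i : ℚ) * X (i + 1)

open MvPolynomial in
/-- The lowering operator `∑ i x_{i-1} ∂_i`. Its coefficient vanishes at `i = 0`, where the truncated
index `i - 1` is therefore harmless. -/
noncomputable def lowering : Derivation ℚ (MvPolynomial ℕ ℚ) (MvPolynomial ℕ ℚ) :=
  mkDerivation ℚ fun i => C (i : ℚ) * X (i - 1)

open MvPolynomial in
/-- The operator `∑ (2 i - m) x_i ∂_i`, diagonal on monomials. -/
noncomputable def weightDerivation (m : ℕ) :
    Derivation ℚ (MvPolynomial ℕ ℚ) (MvPolynomial ℕ ℚ) :=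
  mkDerivation ℚ fun i => C (2 * i - m : ℚ) * X i

open MvPolynomial in
theorem lie_raising_lowering (m : ℕ) :
    ⁅raising m, lowering⁆ = weightDerivation m := by
  refine derivation_ext fun i => ?_
  rw [Derivation.commutator_apply, raising, lowering, weightDerivation]
  simp only [mkDerivation_X, ← smul_eq_C_mul, Derivation.map_smul, smul_smul]
  rcases i with _ | i
  · simp
  · simp only [Nat.add_sub_cancel, ← sub_smul]
    congr 1
    push_cast
    ring

open MvPolynomial in
theorem weightDerivation_monomial (m : ℕ) (d : ℕ →₀ ℕ) :
    weightDerivation m (monomial d 1) =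
      (2 * exponentWeight d - m * d.degree : ℚ) • monomial d 1 := by
  rw [weightDerivation, mkDerivation_monomial, one_smul]
  have hterm : ∀ i ∈ d.support,
      (monomial (d - Finsupp.single i 1) (d i : ℚ) • (C (2 * i - m : ℚ) * X i) :
        MvPolynomial ℕ ℚ) = ((2 * i - m) * d i : ℚ) • monomial d 1 := by
    intro i hi
    rw [smul_eq_mul, mul_left_comm, X, monomial_mul, C_mul_monomial, smul_monomial,
      tsub_add_cancel_of_le
        (Finsupp.single_le_iff.2 (Nat.one_le_iff_ne_zero.2 (Finsupp.mem_support_iff.1 hi)))]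
    simp
  rw [Finsupp.sum, sum_congr rfl hterm, ← sum_smul]
  congr 1
  rw [exponentWeight, Finsupp.weight_apply, Finsupp.degree_apply, Finsupp.sum]
  push_cast
  rw [mul_sum, mul_sum, ← sum_sub_distrib]
  refine sum_congr rfl fun i _ => ?_
  simp
  ring

open MvPolynomial in
theorem raising_mem {m j w : ℕ} {v : MvPolynomial ℕ ℚ}
    (hv : v ∈ restrictSupport ℚ (weightLevel m j w : Set (ℕ →₀ ℕ))) :
    raising m v ∈ restrictSupport ℚ (weightLevel m j (w + 1) : Set (ℕ →₀ ℕ)) := by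
  rw [restrictSupport_eq_span] at hv
  refine Submodule.span_induction ?_ (by simp) (fun x y _ _ hx hy => ?_) (fun a x _ hx => ?_) hv
  · rintro _ ⟨d, hd, rfl⟩
    dsimp only
    rw [raising, mkDerivation_monomial, one_smul]
    refine Submodule.sum_mem _ fun i hi => ?_
    have hi' := Finsupp.mem_support_iff.1 hi
    dsimp only
    rw [smul_eq_mul, mul_left_comm, X, monomial_mul, C_mul_monomial, monomial_mem_restrictSupport]
    rcases eq_or_ne i m with rfl | him
    · right; simp
    · left
      have := (mem_weightLevel.1 hd).2.1 i hi'
      exact sub_single_add_single_mem_weightLevel hd hi' (by omega) (by omega)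
  · rw [map_add]; exact add_mem hx hy
  · rw [Derivation.map_smul]; exact Submodule.smul_mem _ a hx

open MvPolynomial in
theorem lowering_mem {m j w : ℕ} {v : MvPolynomial ℕ ℚ}
    (hv : v ∈ restrictSupport ℚ (weightLevel m j (w + 1) : Set (ℕ →₀ ℕ))) :
    lowering v ∈ restrictSupport ℚ (weightLevel m j w : Set (ℕ →₀ ℕ)) := by
  rw [restrictSupport_eq_span] at hv
  refine Submodule.span_induction ?_ (by simp) (fun x y _ _ hx hy => ?_) (fun a x _ hx => ?_) hv
  · rintro _ ⟨d, hd, rfl⟩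
    dsimp only
    rw [lowering, mkDerivation_monomial, one_smul]
    refine Submodule.sum_mem _ fun i hi => ?_
    have hi' := Finsupp.mem_support_iff.1 hi
    dsimp only
    rw [smul_eq_mul, mul_left_comm, X, monomial_mul, C_mul_monomial, monomial_mem_restrictSupport]
    rcases eq_or_ne i 0 with rfl | hi0
    · right; simp
    · left
      have := (mem_weightLevel.1 hd).2.1 i hi'
      exact sub_single_add_single_mem_weightLevel hd hi' (by omega) (by omega)
  · rw [map_add]; exact add_mem hx hy
  · rw [Derivation.map_smul]; exact Submodule.smul_mem _ a hx

open MvPolynomial in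
theorem lowering_eq_zero {m j : ℕ} {v : MvPolynomial ℕ ℚ}
    (hv : v ∈ restrictSupport ℚ (weightLevel m j 0 : Set (ℕ →₀ ℕ))) : lowering v = 0 := by
  rw [restrictSupport_eq_span] at hv
  refine Submodule.span_induction ?_ (by simp) (fun x y _ _ hx hy => ?_) (fun a x _ hx => ?_) hv
  · rintro _ ⟨d, hd, rfl⟩
    dsimp only
    rw [lowering, mkDerivation_monomial, one_smul]
    refine sum_eq_zero fun i hi => ?_
    have hwt := (mem_weightLevel.1 hd).2.2
    rw [exponentWeight, Finsupp.weight_apply, Finsupp.sum, sum_eq_zero_iff] at hwt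
    have hi0 : i = 0 := by
      simpa [Finsupp.mem_support_iff.1 hi] using hwt i hi
    simp [hi0]
  · rw [map_add, hx, hy, add_zero]
  · rw [Derivation.map_smul, hx, smul_zero]

open MvPolynomial in
theorem raising_lowering_sub {m j w : ℕ} {v : MvPolynomial ℕ ℚ}
    (hv : v ∈ restrictSupport ℚ (weightLevel m j w : Set (ℕ →₀ ℕ))) :
    raising m (lowering v) - lowering (raising m v) = (2 * w - (m * j : ℕ) : ℚ) • v := by
  rw [← Derivation.commutator_apply, lie_raising_lowering]
  rw [restrictSupport_eq_span] at hv
  refine Submodule.span_induction ?_ (by simp) (fun x y _ _ hx hy => ?_) (fun a x _ hx => ?_) hv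
  · rintro _ ⟨d, hd, rfl⟩
    obtain ⟨hdeg, -, hwt⟩ := mem_weightLevel.1 hd
    dsimp only
    rw [weightDerivation_monomial, hdeg, hwt]
    push_cast
    rfl
  · rw [map_add, hx, hy, smul_add]
  · rw [Derivation.map_smul, hx, smul_comm]

open MvPolynomial in
/-- The number of partitions of `w` in a `j × m` box is nondecreasing in `w` up to the middle. -/
theorem card_weightLevel_le_succ {m j w : ℕ} (hw : 2 * w < m * j) :
    #(weightLevel m j w) ≤ #(weightLevel m j (w + 1)) := by
  let V : ℕ → Submodule ℚ (MvPolynomial ℕ ℚ) := fun w =>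
    restrictSupport ℚ (weightLevel m j w : Set (ℕ →₀ ℕ))
  have hfin : ∀ w, Module.finrank ℚ (V w) = #(weightLevel m j w) := fun w => by
    rw [Module.finrank_eq_nat_card_basis
      (basisRestrictSupport ℚ (weightLevel m j w : Set (ℕ →₀ ℕ)))]
    simp
  have : Module.Finite ℚ (V (w + 1)) :=
    Module.Finite.of_basis (basisRestrictSupport ℚ (weightLevel m j (w + 1) : Set (ℕ →₀ ℕ)))
  rw [← hfin, ← hfin]
  let f : V w →ₗ[ℚ] V (w + 1) :=
    (raising m : MvPolynomial ℕ ℚ →ₗ[ℚ] MvPolynomial ℕ ℚ).restrict fun _ hv => raising_mem hv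
  refine LinearMap.finrank_le_finrank_of_injective (f := f) ?_
  rw [← LinearMap.ker_eq_bot, LinearMap.ker_eq_bot']
  rintro ⟨v, hv⟩ hfv
  refine Subtype.ext (eq_zero_of_raising_eq_zero
    (raising m : MvPolynomial ℕ ℚ →ₗ[ℚ] MvPolynomial ℕ ℚ)
    (lowering : MvPolynomial ℕ ℚ →ₗ[ℚ] MvPolynomial ℕ ℚ) V (m * j)
    (fun _ h => lowering_eq_zero h) (fun _ _ h => lowering_mem h)
    (fun _ _ h => raising_lowering_sub h) hw hv ?_)
  exact congrArg Subtype.val hfv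

end Gaussian

/-! ### Gaussian polynomials -/

section GaussianPolynomial

open Finset Polynomial

/-- The Gaussian binomial coefficient `[m + j, j]` as an integer polynomial, defined as the
generating function by size of the partitions in a `j × m` box. -/
noncomputable def gaussPoly (m j : ℕ) : ℤ[X] :=
  ∑ d ∈ boundedExponents m j, X ^ exponentWeight d

theorem coeff_gaussPoly (m j w : ℕ) : (gaussPoly m j).coeff w = #(weightLevel m j w) := by
  rw [gaussPoly, finsetSum_coeff, weightLevel, card_filter]
  push_cast
  exact sum_congr rfl fun d _ => by simp [coeff_X_pow, eq_comm]

theorem coeff_gaussPoly_le_succ {m j w : ℕ} (hw : 2 * w < m * j) :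
    (gaussPoly m j).coeff w ≤ (gaussPoly m j).coeff (w + 1) := by
  rw [coeff_gaussPoly, coeff_gaussPoly]
  exact_mod_cast card_weightLevel_le_succ hw

theorem coeff_gaussPoly_le_of_le {m j v w : ℕ} (hvw : v ≤ w) (hw : 2 * w ≤ m * j) :
    (gaussPoly m j).coeff v ≤ (gaussPoly m j).coeff w := by
  induction w, hvw using Nat.le_induction with
  | base => exact le_rfl
  | succ w _ ih => exact (ih (by omega)).trans (coeff_gaussPoly_le_succ (by omega))

theorem gaussPoly_zero_right (m : ℕ) : gaussPoly m 0 = 1 := by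
  simp [gaussPoly, boundedExponents]

theorem gaussPoly_zero_left (j : ℕ) : gaussPoly 0 j = 1 := by
  have : boundedExponents 0 j = {Finsupp.single 0 j} := by
    ext d
    rw [mem_boundedExponents, mem_singleton]
    constructor
    · rintro ⟨hdeg, hle⟩
      have hd : d = Finsupp.single 0 (d 0) := by
        ext i
        rcases eq_or_ne i 0 with rfl | hi
        · simp
        · rw [Finsupp.single_eq_of_ne hi]
          by_contra h
          exact hi (Nat.le_zero.1 (hle i h))
      rw [hd, Finsupp.degree_single] at hdeg
      rw [hd, hdeg]
    · rintro rfl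
      refine ⟨by simp, fun i hi => ?_⟩
      by_contra h
      exact hi (Finsupp.single_eq_of_ne (by omega))
  simp [gaussPoly, this]

/-- The `q`-Pascal recursion, obtained by distinguishing whether the variable `x_{m+1}` occurs. -/
theorem gaussPoly_succ_succ (m j : ℕ) :
    gaussPoly (m + 1) (j + 1) = gaussPoly m (j + 1) + X ^ (m + 1) * gaussPoly (m + 1) j := by
  -- Monomials without `x_{m+1}`.
  have hunused : {d ∈ boundedExponents (m + 1) (j + 1) | d (m + 1) = 0} =
      boundedExponents m (j + 1) := by
    ext d
    simp only [mem_filter, mem_boundedExponents]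
    constructor
    · rintro ⟨⟨hdeg, hle⟩, h0⟩
      refine ⟨hdeg, fun i hi => ?_⟩
      have := hle i hi
      have : i ≠ m + 1 := by rintro rfl; exact hi h0
      omega
    · rintro ⟨hdeg, hle⟩
      refine ⟨⟨hdeg, fun i hi => (hle i hi).trans (Nat.le_succ m)⟩, ?_⟩
      by_contra h
      have := hle _ h
      omega
  -- Monomials with `x_{m+1}`: divide by it once.
  have hused : ∑ d ∈ boundedExponents (m + 1) (j + 1) with ¬ d (m + 1) = 0,
      (X : ℤ[X]) ^ exponentWeight d = X ^ (m + 1) * gaussPoly (m + 1) j := by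
    rw [gaussPoly, mul_sum]
    have hadd : ∀ d : ℕ →₀ ℕ, d (m + 1) ≠ 0 →
        d - Finsupp.single (m + 1) 1 + Finsupp.single (m + 1) 1 = d := fun d hd =>
      tsub_add_cancel_of_le (Finsupp.single_le_iff.2 (Nat.one_le_iff_ne_zero.2 hd))
    refine sum_nbij' (fun d => d - Finsupp.single (m + 1) 1)
      (fun d => d + Finsupp.single (m + 1) 1) ?_ ?_ ?_ ?_ ?_
    · intro d hd
      obtain ⟨hd, hd0⟩ := mem_filter.1 hd
      obtain ⟨hdeg, hle⟩ := mem_boundedExponents.1 hd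
      refine mem_boundedExponents.2 ⟨?_, fun i hi => hle i fun h => hi (by simp [h])⟩
      have := congrArg Finsupp.degree (hadd d hd0)
      rw [map_add, Finsupp.degree_single] at this
      omega
    · intro d hd
      obtain ⟨hdeg, hle⟩ := mem_boundedExponents.1 hd
      refine mem_filter.2 ⟨mem_boundedExponents.2 ⟨by simp [hdeg], fun i hi => ?_⟩, by simp⟩
      by_cases h : i = m + 1
      · exact h.le
      · exact hle i fun h0 => hi (by simp [h0, Finsupp.single_eq_of_ne h])
    · intro d hd
      exact hadd d (mem_filter.1 hd).2
    · intro d _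
      simp
    · intro d hd
      have := congrArg exponentWeight (hadd d (mem_filter.1 hd).2)
      rw [map_add, exponentWeight_single, one_mul] at this
      rw [← pow_add, ← this, add_comm]
  rw [gaussPoly, ← sum_filter_add_sum_filter_not _ (fun d : ℕ →₀ ℕ => d (m + 1) = 0), hunused,
    hused]
  rfl

/-- The product `(q; q)_m` as an integer polynomial. -/
noncomputable def qFactorialPoly (m : ℕ) : ℤ[X] :=
  ∏ i ∈ range m, (1 - X ^ (i + 1))

theorem qFactorialPoly_succ (m : ℕ) :
    qFactorialPoly (m + 1) = qFactorialPoly m * (1 - X ^ (m + 1)) :=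
  prod_range_succ _ _

theorem one_sub_X_pow_ne_zero {n : ℕ} (hn : 0 < n) : (1 - X ^ n : ℤ[X]) ≠ 0 := by
  rw [← neg_ne_zero, neg_sub]
  simpa using X_pow_sub_C_ne_zero hn (1 : ℤ)

theorem natDegree_one_sub_X_pow (n : ℕ) : (1 - X ^ n : ℤ[X]).natDegree = n := by
  rw [← natDegree_neg, neg_sub]
  simpa using natDegree_X_pow_sub_C (n := n) (r := (1 : ℤ))

theorem reverse_one_sub_X_pow (n : ℕ) : (1 - X ^ n : ℤ[X]).reverse = -(1 - X ^ n) := by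
  rw [reverse, natDegree_one_sub_X_pow, reflect_sub, reflect_monomial, revAt_le le_rfl,
    reflect_one, tsub_self]
  ring

theorem qFactorialPoly_ne_zero (m : ℕ) : qFactorialPoly m ≠ 0 :=
  prod_ne_zero_iff.2 fun _ _ => one_sub_X_pow_ne_zero (Nat.succ_pos _)

theorem two_mul_natDegree_qFactorialPoly (m : ℕ) :
    2 * (qFactorialPoly m).natDegree = m * (m + 1) := by
  induction m with
  | zero => simp [qFactorialPoly]
  | succ m ih =>
    rw [qFactorialPoly_succ, natDegree_mul (qFactorialPoly_ne_zero m)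
      (one_sub_X_pow_ne_zero (Nat.add_one_pos m)), natDegree_one_sub_X_pow, mul_add, ih]
    ring

theorem reverse_qFactorialPoly (m : ℕ) :
    (qFactorialPoly m).reverse = (-1) ^ m * qFactorialPoly m := by
  induction m with
  | zero =>
    rw [qFactorialPoly, range_zero, prod_empty, ← C_1, reverse_C]
    simp
  | succ m ih =>
    rw [qFactorialPoly_succ, reverse_mul_of_domain, ih, reverse_one_sub_X_pow]
    ring

theorem gaussPoly_mul_qFactorialPoly (m j : ℕ) :
    gaussPoly m j * (qFactorialPoly m * qFactorialPoly j) = qFactorialPoly (m + j) := by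
  induction m generalizing j with
  | zero => simp [gaussPoly_zero_left, qFactorialPoly]
  | succ m ihm =>
    induction j with
    | zero => simp [gaussPoly_zero_right, qFactorialPoly]
    | succ j ihj =>
      have h1 := ihm (j + 1)
      have h2 : m + 1 + j = m + j + 1 := by ring
      have h3 : m + 1 + (j + 1) = m + j + 1 + 1 := by ring
      rw [h2, qFactorialPoly_succ m, qFactorialPoly_succ (m + j)] at ihj
      rw [← add_assoc, qFactorialPoly_succ (m + j), qFactorialPoly_succ j] at h1
      rw [h3, gaussPoly_succ_succ, qFactorialPoly_succ m, qFactorialPoly_succ j,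
        qFactorialPoly_succ (m + j + 1), qFactorialPoly_succ (m + j)]
      linear_combination (1 - X ^ (m + 1)) * h1 + X ^ (m + 1) * (1 - X ^ (j + 1)) * ihj

theorem gaussPoly_ne_zero (m j : ℕ) : gaussPoly m j ≠ 0 := fun h =>
  qFactorialPoly_ne_zero (m + j) (by rw [← gaussPoly_mul_qFactorialPoly, h, zero_mul])

theorem natDegree_gaussPoly (m j : ℕ) : (gaussPoly m j).natDegree = m * j := by
  have h := congrArg natDegree (gaussPoly_mul_qFactorialPoly m j)
  rw [natDegree_mul (gaussPoly_ne_zero m j)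
    (mul_ne_zero (qFactorialPoly_ne_zero m) (qFactorialPoly_ne_zero j)),
    natDegree_mul (qFactorialPoly_ne_zero m) (qFactorialPoly_ne_zero j)] at h
  have h1 := two_mul_natDegree_qFactorialPoly m
  have h2 := two_mul_natDegree_qFactorialPoly j
  have h3 := two_mul_natDegree_qFactorialPoly (m + j)
  nlinarith

theorem reverse_gaussPoly (m j : ℕ) : (gaussPoly m j).reverse = gaussPoly m j := by
  have h := congrArg reverse (gaussPoly_mul_qFactorialPoly m j)
  rw [reverse_mul_of_domain, reverse_mul_of_domain, reverse_qFactorialPoly,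
    reverse_qFactorialPoly, reverse_qFactorialPoly, ← gaussPoly_mul_qFactorialPoly] at h
  have hne : (-1 : ℤ[X]) ^ (m + j) * (qFactorialPoly m * qFactorialPoly j) ≠ 0 :=
    mul_ne_zero (pow_ne_zero _ (neg_ne_zero.2 one_ne_zero))
      (mul_ne_zero (qFactorialPoly_ne_zero m) (qFactorialPoly_ne_zero j))
  refine mul_right_cancel₀ hne ?_
  linear_combination h

/-! ### Quotients of Gaussian polynomials -/

/-- With `n = m + j` and `g = gcd(n, j)`, the quotient `(1 - q^g) / (1 - q^n) * [n, j]` is a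
polynomial. -/
theorem one_sub_X_pow_dvd_mul_gaussPoly (m j : ℕ) :
    (1 - X ^ (m + j) : ℤ[X]) ∣ (1 - X ^ Nat.gcd (m + j) j) * gaussPoly m j := by
  refine dvd_one_sub_pow_gcd_mul _ _ _ _ _ (dvd_mul_right _ _) ?_
  rcases j with _ | j
  · simp
  · refine ⟨gaussPoly m j, ?_⟩
    refine mul_right_cancel₀
      (mul_ne_zero (qFactorialPoly_ne_zero m) (qFactorialPoly_ne_zero j)) ?_
    -- This is the absorption identity `(1 - q^(j+1)) [n, j+1] = (1 - q^n) [n-1, j]`.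
    have h1 := gaussPoly_mul_qFactorialPoly m (j + 1)
    have h2 := gaussPoly_mul_qFactorialPoly m j
    rw [← add_assoc, qFactorialPoly_succ j, qFactorialPoly_succ (m + j)] at h1
    rw [← add_assoc]
    linear_combination h1 - (1 - X ^ (m + j + 1)) * h2

/-- Degree and reciprocity of a quotient `(1 - q^k) / (1 - q^n) * [m + j, j]`, whenever it is a
polynomial. -/
theorem natDegree_and_reverse_of_one_sub_X_pow_mul_eq {n k m j : ℕ} (hn : 0 < n) (hk : 0 < k) {P : ℤ[X]}
    (hP : (1 - X ^ n) * P = (1 - X ^ k) * gaussPoly m j) :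
    P ≠ 0 ∧ n + P.natDegree = k + m * j ∧ P.reverse = P := by
  have hne : P ≠ 0 := by
    rintro rfl
    rw [mul_zero] at hP
    exact mul_ne_zero (one_sub_X_pow_ne_zero hk) (gaussPoly_ne_zero m j) hP.symm
  refine ⟨hne, ?_, ?_⟩
  · have h := congrArg natDegree hP
    rwa [natDegree_mul (one_sub_X_pow_ne_zero hn) hne, natDegree_mul (one_sub_X_pow_ne_zero hk)
      (gaussPoly_ne_zero m j), natDegree_one_sub_X_pow, natDegree_one_sub_X_pow,
      natDegree_gaussPoly] at h
  · have h := congrArg reverse hP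
    rw [reverse_mul_of_domain, reverse_mul_of_domain, reverse_gaussPoly, reverse_one_sub_X_pow,
      reverse_one_sub_X_pow, neg_mul, neg_mul, neg_inj, ← hP] at h
    exact mul_left_cancel₀ (one_sub_X_pow_ne_zero hn) h

/-- If `(1 - q^g) / (1 - q^n) * [m + j, j]` is a polynomial and `0 < g ≤ n`, then its coefficients
are nonnegative: unimodality gives this up to half the degree, and reciprocity beyond it. -/
theorem coeff_nonneg_of_one_sub_X_pow_mul_eq {n g m j : ℕ} (hg : 0 < g) (hgn : g ≤ n) {A : ℤ[X]}
    (hA : (1 - X ^ n) * A = (1 - X ^ g) * gaussPoly m j) (i : ℕ) : 0 ≤ A.coeff i := by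
  obtain ⟨-, hdeg, hrev⟩ := natDegree_and_reverse_of_one_sub_X_pow_mul_eq (hg.trans_le hgn) hg hA
  have hhalf : ∀ i, 2 * i ≤ A.natDegree → 0 ≤ A.coeff i := by
    intro i
    induction i using Nat.strong_induction_on with
    | _ i ih =>
      intro hi
      -- The coefficient of `q ^ i` gives `A_i = A_{i-n} + (G_i - G_{i-g})`, where `G` is the Gaussian
      -- polynomial. As `2 * i ≤ deg A ≤ deg G`, the index `i` is not beyond the middle of `G`.
      have hcoeff := congrArg (fun p : ℤ[X] => p.coeff i) hA
      simp only [sub_mul, one_mul, coeff_sub, coeff_X_pow_mul'] at hcoeff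
      have hA_nonneg : 0 ≤ if n ≤ i then A.coeff (i - n) else 0 := by
        split_ifs
        · exact ih _ (by omega) (by omega)
        · exact le_rfl
      have hG_nonneg : (if g ≤ i then (gaussPoly m j).coeff (i - g) else 0) ≤
          (gaussPoly m j).coeff i := by
        split_ifs
        · exact coeff_gaussPoly_le_of_le (Nat.sub_le i g) (by omega)
        · rw [coeff_gaussPoly]; positivity
      linarith
  rcases le_total (2 * i) A.natDegree with hi | hi
  · exact hhalf i hi
  rcases le_or_gt i A.natDegree with hi' | hi'
  · rw [← hrev, coeff_reverse, revAt_le hi']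
    exact hhalf _ (by omega)
  · rw [coeff_eq_zero_of_natDegree_lt hi']

theorem exists_nonneg_one_sub_X_pow_mul_eq {m j k : ℕ} (hmj : 0 < m + j)
    (hk : Nat.gcd (m + j) j ∣ k) :
    ∃ P : ℤ[X], (1 - X ^ (m + j)) * P = (1 - X ^ k) * gaussPoly m j ∧ ∀ i, 0 ≤ P.coeff i := by
  obtain ⟨A, hA⟩ := one_sub_X_pow_dvd_mul_gaussPoly m j
  obtain ⟨t, rfl⟩ := hk
  set g := Nat.gcd (m + j) j with hg
  have hA_nonneg := coeff_nonneg_of_one_sub_X_pow_mul_eq (Nat.gcd_pos_of_pos_left j hmj)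
    (Nat.gcd_le_left j hmj) hA.symm
  refine ⟨(∑ i ∈ range t, (X ^ g) ^ i) * A, ?_, fun i => ?_⟩
  · have hgeom := mul_geom_sum (X ^ g : ℤ[X]) t
    rw [← pow_mul] at hgeom
    linear_combination (-∑ i ∈ range t, ((X : ℤ[X]) ^ g) ^ i) * hA - gaussPoly m j * hgeom
  · rw [sum_mul, finsetSum_coeff]
    refine sum_nonneg fun l _ => ?_
    rw [← pow_mul, coeff_X_pow_mul']
    split_ifs
    · exact hA_nonneg _
    · exact le_rfl

/-! ### Passage to rational functions -/

/-- The embedding of `ℤ[q]` into the field `ℚ(q)`. -/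
noncomputable def intPolyToRatFunc : ℤ[X] →+* RatFunc ℚ :=
  (algebraMap ℚ[X] (RatFunc ℚ)).comp (mapRingHom (Int.castRingHom ℚ))

theorem intPolyToRatFunc_injective : Function.Injective intPolyToRatFunc :=
  (RatFunc.algebraMap_injective ℚ).comp (map_injective _ Int.cast_injective)

@[simp]
theorem intPolyToRatFunc_X : intPolyToRatFunc X = RatFunc.X := by
  simp [intPolyToRatFunc]

theorem intPolyToRatFunc_qFactorialPoly (m : ℕ) :
    intPolyToRatFunc (qFactorialPoly m) = qShiftedFactorial RatFunc.X RatFunc.X m := by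
  rw [qFactorialPoly, qShiftedFactorial, map_prod]
  exact prod_congr rfl fun i _ => by simp [pow_succ']

theorem intPolyToRatFunc_gaussPoly (m j : ℕ) :
    intPolyToRatFunc (gaussPoly m j) = qBinomial RatFunc.X (m + j) j := by
  have hne : ∀ i, qShiftedFactorial (RatFunc.X : RatFunc ℚ) RatFunc.X i ≠ 0 := fun i => by
    rw [← intPolyToRatFunc_qFactorialPoly]
    exact (map_ne_zero_iff _ intPolyToRatFunc_injective).2 (qFactorialPoly_ne_zero i)
  rw [qBinomial, if_pos (Nat.le_add_left j m), Nat.add_sub_cancel,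
    eq_div_iff (mul_ne_zero (hne j) (hne m))]
  simp only [← intPolyToRatFunc_qFactorialPoly, ← map_mul]
  rw [← gaussPoly_mul_qFactorialPoly, mul_comm (qFactorialPoly j)]

end GaussianPolynomial

theorem theorem2p1 (n k j : ℕ) (hn : 0 < n) (hk : 0 < k) (hj : j ≤ n)
    (hg : k ≡ 0 [MOD Nat.gcd n j]) :
    ∃ P : Polynomial ℤ,
      algebraMap (Polynomial ℚ) (RatFunc ℚ) (P.map (Int.castRingHom ℚ)) = andrewsA n j k ∧
      P ≠ 0 ∧
      (P.natDegree : ℤ) = (j : ℤ) * ((n : ℤ) - (j : ℤ)) + (k : ℤ) - (n : ℤ) ∧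
      P.reverse = P ∧
      ∀ i : ℕ, 0 ≤ P.coeff i := by
  obtain ⟨m, rfl⟩ := Nat.exists_eq_add_of_le' hj
  obtain ⟨P, hP, hnonneg⟩ :=
    exists_nonneg_one_sub_X_pow_mul_eq hn ((Nat.modEq_zero_iff_dvd).1 hg)
  obtain ⟨hne, hdeg, hrev⟩ := natDegree_and_reverse_of_one_sub_X_pow_mul_eq hn hk hP
  refine ⟨P, ?_, hne, ?_, hrev, hnonneg⟩
  · change intPolyToRatFunc P = _
    have hden : intPolyToRatFunc (1 - Polynomial.X ^ (m + j)) ≠ 0 :=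
      (map_ne_zero_iff _ intPolyToRatFunc_injective).2 (one_sub_X_pow_ne_zero hn)
    have h := congrArg intPolyToRatFunc hP
    rw [map_mul, map_mul, intPolyToRatFunc_gaussPoly] at h
    simp only [map_sub, map_one, map_pow, intPolyToRatFunc_X] at h hden
    rw [andrewsA, div_mul_eq_mul_div, eq_div_iff hden, mul_comm, h]
  · have : ((m + j : ℕ) : ℤ) + P.natDegree = k + m * j := by exact_mod_cast hdeg
    push_cast at this ⊢
    linear_combination this
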